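/- All graphs are finite and simple. An \emph{acyclic coloring} of a graph $G$ is a proper vertex coloring $c$ such that for any two colors $i,j$ the vertices of colors $i$ and $j$ induce a forest; $|c|$ is the number of colors used. An \emph{acyclic recoloring step} turns an acyclic coloring $c$ into an acyclic coloring $c'$ by choosing a color $i$ of $c$ and giving each vertex $u$ of color $i$ some color of $c$ (depending on $u$) that does not occur in the closed neighborhood of $u$, all other vertices keeping their colors. Let $\prec_a$ be the transitive closure of the relation "$c'$ arises from $c$ by an acyclic recoloring step". The \emph{acyclic b-chromatic number} $A_b(G)$ is the maximum of $|c|$ over the minimal elements $c$ of $\prec_a$. For a vertex $v$, let $P=\{A_0,A_1,\dots,A_k\}$ ($k\ge 0$) range over the weak partitions of the neighborhood $N_G(v)$ into disjoint sets, where $A_0$ may be empty and $|A_i|\ge 2$ for $1\le i\le k$. Let $\mathrm{elp}_G(v,P)$ be the maximum number of paths of even length that avoid $v$, each joining two different vertices of one of the sets $A_1,\dots,A_k$, and such that no even vertex (second, fourth, ...) of one path lies on another of the paths. The \emph{acyclic degree} of $v$ is $d^a_G(v)=\max_P\left(|A_0|+k+\mathrm{elp}_G(v,P)\right)$. With the vertices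 ordered so that $d_G^a(v_1)\ge d_G^a(v_2)\ge\cdots$, let $m_a(G)=\max\{i : i-1\le d_G^a(v_i)\}$. Let $\Delta(G)$ be the maximum degree. For $n\ge 1$ let $H_n$ be the graph with vertices $v$, $x_1,\dots,x_{2n}$, $y_1,\dots,y_{n(2n-1)}$ in which $v$ is adjacent to every $x_j$, and, for each $\ell\in\{1,\dots,n\}$, both $x_{2\ell-1}$ and $x_{2\ell}$ are adjacent to every $y_k$ with $(2n-1)(\ell-1)+1\le k\le(2n-1)\ell$; there are no other edges. Let $G_1=H_1=C_4$. For $n\ge 2$ let $G_n$ be obtained from $2n^2+1$ disjoint copies $H_{n,0},\dots,H_{n,2n^2}$ of $H_n$, with vertices $v^i,x^i_j,y^i_k$, by identifying $y^{i-1}_{n(2n-1)}$ with $y^i_1$ for $1\le i\le 2n^2$. \textbf{Theorem.} The graphs $G_1,G_2,\dots$ form an infinite family: they are pairwise non-isomorphic, and $\Delta(G_n)=2n$. For every $n\ge 1$, $$A_b(G_n)=m_a(G_n)=\tfrac12\,\Delta(G_n)^2+1 .$$ Moreover, for every $n\ge 2$ the map $c:V(G_n)\to\mathbb Z/(2n^2+1)$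 given, for $0\le i\le 2n^2$, by $c(y^i_1)=i$, $c(y^i_{n(2n-1)})=i+1$, $c(y^i_k)=i+k$ for $2\le k\le n(2n-1)-1$, $c(x^i_{2\ell-1})=c(x^i_{2\ell})=i+n(2n-1)-1+\ell$ for $1\le\ell\le n$, and $c(v^i)=i+2n^2$, is a well-defined acyclic coloring of $G_n$ that uses all $2n^2+1$ colors and is a minimal element of $\prec_a$. -/

import Mathlib

/-!
# Acyclic b-colorings, acyclic degrees, and chains of gadgets
-/

namespace AcyclicB

section Colorings

variable {V : Type*} {α : Type*}

/-- An acyclic coloring: a proper vertex coloring such that the vertices of any two colors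
induce a forest. -/
def IsAcyclicColoring (G : SimpleGraph V) (c : V → α) : Prop :=
  (∀ u w, G.Adj u w → c u ≠ c w) ∧
    ∀ i j : α, (G.induce {u | c u = i ∨ c u = j}).IsAcyclic

/-- The number of colors used by a coloring. -/
noncomputable def numColors (c : V → α) : ℕ := (Set.range c).ncard

/-- `AcyclicStep G c' c`: the acyclic coloring `c'` arises from the acyclic coloring `c` by an
acyclic recoloring step.  One color `i` of `c` is removed: each vertex `u` of color `i` gets a
color of `c` that does not occur in the closed neighborhood of `u` (the new color may depend on
`u`), and all the other vertices keep their colors. -/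
def AcyclicStep (G : SimpleGraph V) (c' c : V → α) : Prop :=
  IsAcyclicColoring G c ∧ IsAcyclicColoring G c' ∧
    ∃ i ∈ Set.range c,
      (∀ u, c u ≠ i → c' u = c u) ∧
      (∀ u, c u = i →
        c' u ∈ Set.range c ∧ c' u ≠ c u ∧ ∀ w, G.Adj u w → c' u ≠ c w)

/-- The strict order on acyclic colorings: the transitive closure of `AcyclicStep`. -/
def AcyclicLT (G : SimpleGraph V) : (V → α) → (V → α) → Prop :=
  Relation.TransGen (AcyclicStep G)

/-- Minimal elements of the order `AcyclicLT` on the acyclic colorings of `G`. -/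
def IsMinimalAcyclicColoring (G : SimpleGraph V) (c : V → α) : Prop :=
  IsAcyclicColoring G c ∧ ∀ c' : V → α, ¬ AcyclicLT G c' c

/-- The acyclic b-chromatic number `A_b(G)`: the maximum number of colors of a minimal acyclic
coloring.  (For a finite graph the numbers below are bounded by the order of `G`.) -/
noncomputable def acyclicBChromaticNumber (G : SimpleGraph V) : ℕ :=
  sSup {k | ∃ c : V → ℕ, IsMinimalAcyclicColoring G c ∧ numColors c = k}

end Colorings

section AcyclicDegree

variable {V : Type*}

/-- The even vertices (the second, the fourth, ...) of a walk.  `Walk.getVert` counts from `0`. -/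
def evenVertices {G : SimpleGraph V} {a b : V} (p : G.Walk a b) : Set V :=
  {z | ∃ t, Odd t ∧ t ≤ p.length ∧ p.getVert t = z}

/-- Two walks are even-vertex internally disjoint (EVI disjoint): no common vertex of the two is
an even vertex of one of them. -/
def EVIDisjoint {G : SimpleGraph V} {a b a' b' : V} (p : G.Walk a b) (q : G.Walk a' b') : Prop :=
  ∀ z ∈ p.support, z ∈ q.support → z ∉ evenVertices p ∧ z ∉ evenVertices q

/-- A weak partition `{A₀, A₁, …, A_k}` of the neighborhood of `v`: the set `A₀` may be empty and
each of the sets `A₁, …, A_k`, the members of `parts`, has at least two elements. -/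
structure IsWeakPartition (G : SimpleGraph V) (v : V)
    (A₀ : Finset V) (parts : Finset (Finset V)) : Prop where
  two_le : ∀ A ∈ parts, 2 ≤ A.card
  disjoint_zero : ∀ A ∈ parts, Disjoint A₀ A
  disjoint_parts : ∀ A ∈ parts, ∀ B ∈ parts, A ≠ B → Disjoint A B
  cover : ∀ z, G.Adj v z ↔ z ∈ A₀ ∨ ∃ A ∈ parts, z ∈ A

/-- A path of even length that avoids `v` and joins two different vertices of one of the sets
in `parts`. -/
structure LinkingPath (G : SimpleGraph V) (v : V) (parts : Finset (Finset V)) where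
  /-- the first vertex -/
  fst : V
  /-- the last vertex -/
  lst : V
  /-- the path -/
  walk : G.Walk fst lst
  isPath : walk.IsPath
  even_length : Even walk.length
  avoids : v ∉ walk.support
  ne : fst ≠ lst
  same_part : ∃ A ∈ parts, fst ∈ A ∧ lst ∈ A

/-- `elp_G(v, P)`: the maximum number of pairwise EVI disjoint paths of even length that avoid `v`
and have both ends in one of the sets in `parts`. -/
noncomputable def elp (G : SimpleGraph V) (v : V) (parts : Finset (Finset V)) : ℕ :=
  sSup {m | ∃ p : Fin m → LinkingPath G v parts,
    ∀ s t, s ≠ t → EVIDisjoint (p s).walk (p t).walk}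

/-- The acyclic degree `d_G^a(v)`: the maximum of `|A₀| + k + elp_G(v, P)` over all the weak
partitions `P = {A₀, A₁, …, A_k}` of the neighborhood of `v`. -/
noncomputable def acyclicDegree (G : SimpleGraph V) (v : V) : ℕ :=
  sSup {d | ∃ (A₀ : Finset V) (parts : Finset (Finset V)),
    IsWeakPartition G v A₀ parts ∧ d = A₀.card + parts.card + elp G v parts}

/-- The `m_a`-degree `m_a(G)`: the largest position `i`, counted from `1`, such that
`i - 1 ≤ d_G^a(v_i)`, where the vertices `v_1, v_2, …` are ordered by non-increasing acyclic
degree.  In the code `r = i - 1`, and `e r` is `v_i`. -/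
noncomputable def maDegree [Fintype V] (G : SimpleGraph V) : ℕ :=
  sSup {i | ∃ e : Fin (Fintype.card V) ≃ V,
    Antitone (fun r => acyclicDegree G (e r)) ∧
      ∃ r : Fin (Fintype.card V), i = (r : ℕ) + 1 ∧ (r : ℕ) ≤ acyclicDegree G (e r)}

end AcyclicDegree

section Gadgets

/-- The vertices of the gadget `H_n`: `v`, `x_1, …, x_{2n}`, and `y_1, …, y_{n(2n-1)}`.
The indices are shifted: `x j` is `x_{j+1}` and `y k` is `y_{k+1}`. -/
inductive GadgetVertex (n : ℕ) : Type
  | v : GadgetVertex n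
  | x (j : Fin (2 * n)) : GadgetVertex n
  | y (k : Fin (n * (2 * n - 1))) : GadgetVertex n

/-- The gadget `H_n` (for `n ≥ 1`): `v` is joined to all the vertices `x_j`, and both `x_{2ℓ-1}`
and `x_{2ℓ}` are joined to the `ℓ`-th block
`y_{(2n-1)(ℓ-1)+1}, …, y_{(2n-1)ℓ}` of `2n-1` vertices `y_k`, for `ℓ = 1, …, n`. -/
def gadget (n : ℕ) : SimpleGraph (GadgetVertex n) :=
  SimpleGraph.fromRel fun a b =>
    match a, b with
    | .v, .x _ => True
    | .x j, .y k => (k : ℕ) / (2 * n - 1) = (j : ℕ) / 2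
    | _, _ => False

/-- The vertices of the chain of `M` copies of `H_n`, numbered from `0`, in which the last vertex
`y_{n(2n-1)}` of each copy is identified with the first vertex `y_1` of the next copy.  The
vertices `y` are numbered from `0` along the chain: a copy contributes `n(2n-1)` consecutive
ones, the last of which is the first of the next copy. -/
inductive ChainVertex (n M : ℕ) : Type
  | v (i : Fin M) : ChainVertex n M
  | x (i : Fin M) (j : Fin (2 * n)) : ChainVertex n M
  | y (p : Fin (M * (n * (2 * n - 1) - 1) + 1)) : ChainVertex n M

theorem chain_index_lt {M N i k : ℕ} (hi : i < M) (hk : k < N) :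
    i * (N - 1) + k < M * (N - 1) + 1 := by
  have h1 : (i + 1) * (N - 1) ≤ M * (N - 1) := Nat.mul_le_mul_right _ hi
  have h2 : (i + 1) * (N - 1) = i * (N - 1) + (N - 1) := by ring
  omega

/-- The position of the vertices of the `i`-th copy of `H_n` in the chain. -/
def inCopy {n M : ℕ} (i : Fin M) : GadgetVertex n → ChainVertex n M
  | .v => .v i
  | .x j => .x i j
  | .y k => .y ⟨i * (n * (2 * n - 1) - 1) + k, chain_index_lt i.2 k.2⟩

/-- The chain of `M` copies of `H_n`: the union of the copies. -/
def gadgetChain (n M : ℕ) : SimpleGraph (ChainVertex n M) :=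
  ⨆ i : Fin M, (gadget n).map (inCopy i)

/-- The chain as a sum type, which shows that it has finitely many vertices. -/
def chainVertexEquiv (n M : ℕ) :
    (Fin M ⊕ (Fin M × Fin (2 * n)) ⊕ Fin (M * (n * (2 * n - 1) - 1) + 1)) ≃ ChainVertex n M where
  toFun
    | .inl i => .v i
    | .inr (.inl (i, j)) => .x i j
    | .inr (.inr p) => .y p
  invFun
    | .v i => .inl i
    | .x i j => .inr (.inl (i, j))
    | .y p => .inr (.inr p)
  left_inv := by rintro (_ | ⟨_, _⟩ | _) <;> rfl
  right_inv := by rintro (_ | _ | _) <;> rfl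

instance (n M : ℕ) : Fintype (ChainVertex n M) := Fintype.ofEquiv _ (chainVertexEquiv n M)

noncomputable instance (n M : ℕ) : DecidableRel (gadgetChain n M).Adj := Classical.decRel _

/-- The number of gadgets in `G_n`: `G_1` is the single gadget `H_1`, a 4-cycle, and `G_n` is a
chain of `2n²+1` gadgets for `n ≥ 2`. -/
def numGadgets (n : ℕ) : ℕ := if n = 1 then 1 else 2 * n ^ 2 + 1

/-- The graph `G_n`. -/
abbrev extremalGraph (n : ℕ) : SimpleGraph (ChainVertex n (numGadgets n)) :=
  gadgetChain n (numGadgets n)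

/-- The explicit coloring of the chain of `2n²+1` gadgets `H_n` with the elements of the integers
modulo `2n²+1`.  In the usual numbering, where `x j` is `x_{j+1}` and `y k` is `y_{k+1}`, the
`i`-th copy (`i = 0, …, 2n²`) has the colors
`c(y_1) = i`, `c(y_{n(2n-1)}) = i + 1`, `c(y_k) = i + k` for `2 ≤ k ≤ n(2n-1) - 1`,
`c(x_{2ℓ-1}) = c(x_{2ℓ}) = i + n(2n-1) - 1 + ℓ` for `1 ≤ ℓ ≤ n`, and `c(v) = i + 2n²`. -/
structure IsCyclicChainColoring (n : ℕ)
    (c : ChainVertex n (2 * n ^ 2 + 1) → ZMod (2 * n ^ 2 + 1)) : Prop where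
  y_first : ∀ (i : Fin (2 * n ^ 2 + 1)) (k : Fin (n * (2 * n - 1))), (k : ℕ) + 1 = 1 →
    c (inCopy i (.y k)) = ((i : ℕ) : ZMod (2 * n ^ 2 + 1))
  y_last : ∀ (i : Fin (2 * n ^ 2 + 1)) (k : Fin (n * (2 * n - 1))),
    (k : ℕ) + 1 = n * (2 * n - 1) →
    c (inCopy i (.y k)) = (((i : ℕ) + 1 : ℕ) : ZMod (2 * n ^ 2 + 1))
  y_middle : ∀ (i : Fin (2 * n ^ 2 + 1)) (k : Fin (n * (2 * n - 1))),
    2 ≤ (k : ℕ) + 1 → (k : ℕ) + 1 ≤ n * (2 * n - 1) - 1 →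
    c (inCopy i (.y k)) = (((i : ℕ) + ((k : ℕ) + 1) : ℕ) : ZMod (2 * n ^ 2 + 1))
  x_pair : ∀ (i : Fin (2 * n ^ 2 + 1)) (j : Fin (2 * n)), c (inCopy i (.x j)) =
    (((i : ℕ) + (n * (2 * n - 1) - 1) + ((j : ℕ) / 2 + 1) : ℕ) : ZMod (2 * n ^ 2 + 1))
  v_top : ∀ i : Fin (2 * n ^ 2 + 1),
    c (inCopy i .v) = (((i : ℕ) + 2 * n ^ 2 : ℕ) : ZMod (2 * n ^ 2 + 1))

end Gadgets

end AcyclicB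

/-!
Let `c` be a minimal acyclic coloring with `k` colors.  Its color classes cannot be removed, and
recoloring the vertices of a class one after the other shows that each class contains a vertex `u`
that is stuck: in some acyclic coloring with the same colors, `u` cannot be recolored on its own.
Each color missing at `u` then closes a bicolored cycle through `u`.  These cycles without `u` are
paths of even length between neighbors of equal color, and they are EVI disjoint because the even
vertices of a path have the missing color that the path belongs to.  Hence `u` has acyclic degree
at least `k - 1` (`card_le_acyclicDegree_add_one`), and with one such vertex in each class this
gives `A_b(G) ≤ m_a(G)` (`acyclicBChromaticNumber_le_maDegree`).

On the other hand the first and the last edges of EVI disjoint paths are pairwise different edges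
leading out of the neighborhood of the given vertex.  Counting them gives `d^a_G(v) ≤ Δ²/2` for
`Δ ≥ 2` (`two_mul_acyclicDegree_le`), and therefore `m_a(G) ≤ Δ²/2 + 1`.

For the chains of gadgets, `Δ = 2n`, so that everything follows from a minimal acyclic coloring
with `2n² + 1` colors.  In the cyclic coloring `chainColoring` each vertex `x` sees pairwise
different colors, and each edge has an end `x`; so two color classes induce a star forest.  In each
gadget all the colors occur, and a color other than that of `v` is the color of a neighbor of `v`
or of some `y` that is opposite to `v` in a 4-cycle whose other two vertices have equal colors.  So
`v` is locked (`IsLocked`), and as for `n ≥ 2` each color is the color of some `v`, no color class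
can be recolored.  For `n = 1` there is only one `v`, but all the vertices of the 4-cycle are
locked.
-/

namespace AcyclicB

/-! ### Acyclic colorings and their cycles -/

section Colorings

variable {V α β : Type*} {G : SimpleGraph V} {c : V → α}

theorem eq_of_ne_of_two_colors {i j x y z : α} (hx : x ≠ i → x = j) (hy : y ≠ i → y = j)
    (hz : z ≠ i → z = j) (hxy : x ≠ y) (hxz : x ≠ z) : y = z := by
  by_cases h1 : x = i <;> by_cases h2 : y = i <;> by_cases h3 : z = i <;> grind

/-- Acyclicity of a coloring in terms of the cycles of the graph itself. -/
theorem isAcyclicColoring_iff : IsAcyclicColoring G c ↔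
    (∀ u w, G.Adj u w → c u ≠ c w) ∧
      ∀ i j : α, ∀ (w : V) (p : G.Walk w w), p.IsCycle → ∃ x ∈ p.support, c x ≠ i ∧ c x ≠ j := by
  refine and_congr_right fun _ => forall₂_congr fun i j => ⟨fun h w p hp => ?_, fun h w p hp => ?_⟩
  · by_contra! hcon
    have hs : ∀ x ∈ p.support, x ∈ {u | c u = i ∨ c u = j} := fun x hx =>
      or_iff_not_imp_left.2 (hcon x hx)
    refine h (p.induce _ hs) ?_
    rw [← SimpleGraph.Walk.map_induce p hs] at hp
    exact (SimpleGraph.Walk.isCycle_map_iff_of_injective Subtype.val_injective).1 hp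
  · obtain ⟨x, hx, hi, hj⟩ := h _ _
      (hp.map (f := (SimpleGraph.Embedding.induce _).toHom) Subtype.val_injective)
    rw [SimpleGraph.Walk.support_map, List.mem_map] at hx
    obtain ⟨⟨y, hy⟩, -, rfl⟩ := hx
    exact hy.elim hi hj

theorem IsAcyclicColoring.comp_injective (hc : IsAcyclicColoring G c) {f : α → β}
    (hf : Function.Injective f) : IsAcyclicColoring G (f ∘ c) := by
  rw [isAcyclicColoring_iff] at hc ⊢
  refine ⟨fun u w h => hf.ne (hc.1 u w h), fun i j w p hp => ?_⟩
  by_contra! hcon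
  -- The first two vertices of the cycle provide colors of `c` lying over `i` and `j`.
  cases p with
  | nil => exact hp.ne_nil rfl
  | @cons _ z _ hwz q =>
    obtain ⟨x, hx, h1, h2⟩ := hc.2 (c w) (c z) _ _ hp
    have hfx := hcon x hx
    have hfw := hcon w (by simp)
    have hfz := hcon z (by simp)
    exact hf.ne (hc.1 _ _ hwz) (eq_of_ne_of_two_colors hfx hfw hfz (hf.ne h1) (hf.ne h2))

/-- If every edge has an end whose neighbors have pairwise different colors, then any two color
classes of a proper coloring induce a star forest. -/
theorem isAcyclicColoring_of_injOn_neighborSet {X : Set V}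
    (hproper : ∀ u w, G.Adj u w → c u ≠ c w) (hX : ∀ u w, G.Adj u w → u ∈ X ∨ w ∈ X)
    (hinj : ∀ x ∈ X, Set.InjOn c (G.neighborSet x)) : IsAcyclicColoring G c := by
  classical
  refine isAcyclicColoring_iff.2 ⟨hproper, fun i j w p hp => ?_⟩
  by_contra! hcon
  obtain ⟨x, hxX, hx⟩ : ∃ x ∈ X, x ∈ p.support := by
    cases p with
    | nil => exact absurd rfl hp.ne_nil
    | @cons _ z _ hwz q =>
      exact (hX _ _ hwz).elim (fun h => ⟨_, h, by simp⟩) (fun h => ⟨_, h, by simp⟩)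
  have hq := hp.rotate hx
  have hsupp : ∀ z ∈ (p.rotate x hx).support, z ∈ p.support := fun z hz => by
    simpa using hz
  have hnil := hq.not_nil
  have h1 := hcon _ (hsupp _ ((p.rotate x hx).getVert_mem_support 1))
  have h2 := hcon _ (hsupp _ ((p.rotate x hx).getVert_mem_support ((p.rotate x hx).length - 1)))
  have h3 := hcon x hx
  have a1 := (p.rotate x hx).adj_snd hnil
  have a2 := ((p.rotate x hx).adj_penultimate hnil).symm
  refine hq.snd_ne_penultimate (hinj x hxX a1 a2 ?_)
  exact eq_of_ne_of_two_colors h3 h1 h2 (hproper _ _ a1) (hproper _ _ a2)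

/-- A vertex whose color cannot be changed on its own: every other color occurs in its
neighborhood or closes a 4-cycle through it whose remaining vertices are colored with two
colors. -/
def IsLocked (G : SimpleGraph V) (c : V → α) (u : V) : Prop :=
  ∀ a ∈ Set.range c, a ≠ c u → (∃ w, G.Adj u w ∧ c w = a) ∨
    ∃ x y z, G.Adj u x ∧ G.Adj x y ∧ G.Adj y z ∧ G.Adj z u ∧ x ≠ z ∧ u ≠ y ∧ c x = c z ∧ c y = a

theorem IsLocked.comp {u : V} (h : IsLocked G c u) (f : α → β) : IsLocked G (f ∘ c) u := by
  rintro _ ⟨w, rfl⟩ hne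
  obtain ⟨w', h1, h2⟩ | ⟨x, y, z, h1, h2, h3, h4, h5, h6, h7, h8⟩ :=
    h (c w) ⟨w, rfl⟩ fun h => hne (congrArg f h)
  · exact Or.inl ⟨w', h1, congrArg f h2⟩
  · exact Or.inr ⟨x, y, z, h1, h2, h3, h4, h5, h6, congrArg f h7, congrArg f h8⟩

theorem isMinimalAcyclicColoring_of_isLocked (hc : IsAcyclicColoring G c)
    (h : ∀ i ∈ Set.range c, ∃ u, c u = i ∧ IsLocked G c u) : IsMinimalAcyclicColoring G c := by
  refine ⟨hc, fun c' hlt => ?_⟩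
  obtain ⟨d, -, -, hd, i, hi, hkeep, hnew⟩ := Relation.TransGen.tail'_iff.1 hlt
  obtain ⟨u, rfl, hu⟩ := h i hi
  obtain ⟨hr, hne, hadj⟩ := hnew u rfl
  obtain ⟨w, h1, h2⟩ | ⟨x, y, z, h1, h2, h3, h4, h5, h6, h7, h8⟩ := hu _ hr hne
  · exact hadj w h1 h2.symm
  · have hx := hkeep x (hc.1 _ _ h1).symm
    have hz := hkeep z (hc.1 _ _ h4)
    have hy := hkeep y (h8.trans_ne hne)
    obtain ⟨t, ht, n1, n2⟩ := (isAcyclicColoring_iff.1 hd).2 (d u) (d x) u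
      (.cons h1 (.cons h2 (.cons h3 (.cons h4 .nil)))) (by
        have := h1.ne; have := h2.ne; have := h3.ne; have := h4.ne
        rw [SimpleGraph.Walk.cons_isCycle_iff]
        simp
        grind)
    simp only [SimpleGraph.Walk.support_cons, SimpleGraph.Walk.support_nil, List.mem_cons,
      List.not_mem_nil, or_false] at ht
    grind

/-- Along a walk with vertices of two colors only, the colors of a proper coloring alternate. -/
theorem color_getVert_of_two_colors (hc : ∀ u w, G.Adj u w → c u ≠ c w) {a b : α} {x z : V}
    (p : G.Walk x z) (hp : ∀ y ∈ p.support, c y = a ∨ c y = b) (hx : c x = b) {t : ℕ}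
    (ht : t ≤ p.length) : c (p.getVert t) = if Even t then b else a := by
  induction t with
  | zero => simp [hx]
  | succ t ih =>
    have h1 := ih (by omega)
    have h2 := hc _ _ (p.adj_getVert_succ (by omega : t < p.length))
    have h3 := hp _ (p.getVert_mem_support (t + 1))
    have h4 := hp _ (p.getVert_mem_support t)
    by_cases h : Even t <;> simp only [Nat.even_add_one, h] at h1 ⊢ <;> grind

open Classical in
/-- If giving a vertex `u` a color `a` that is absent from its neighborhood destroys acyclicity,
then the resulting bicolored cycle, with `u` removed, is an even path between two neighbors of `u`
of the same color whose even vertices all have the color `a`. -/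
theorem exists_path_of_not_isAcyclicColoring_update (hc : IsAcyclicColoring G c) {u : V} {a : α}
    (ha : ∀ w, G.Adj u w → c w ≠ a) (hna : ¬ IsAcyclicColoring G (Function.update c u a)) :
    ∃ (x z : V) (p : G.Walk x z), p.IsPath ∧ Even p.length ∧ u ∉ p.support ∧ x ≠ z ∧
      G.Adj u x ∧ G.Adj u z ∧ c x = c z ∧
      ∀ t ≤ p.length, c (p.getVert t) = if Even t then c x else a := by
  have hproper : ∀ v w, G.Adj v w → Function.update c u a v ≠ Function.update c u a w := by
    intro v w hvw
    have h1 := hc.1 v w hvw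
    have := hvw.ne
    have h2 := ha w
    have h3 := ha v
    have := hvw.symm
    grind [Function.update_apply]
  rw [isAcyclicColoring_iff] at hna
  push Not at hna
  obtain ⟨i, j, w, q, hq, hcol⟩ := hna hproper
  -- Away from `u` the colors have not changed, so a bicolored cycle has to go through `u`.
  have hu : u ∈ q.support := by
    by_contra hu
    obtain ⟨x, hx, h1, h2⟩ := (isAcyclicColoring_iff.1 hc).2 i j w q hq
    have hxu : x ≠ u := fun h => hu (h ▸ hx)
    have := hcol x hx
    rw [Function.update_of_ne hxu] at this
    exact h2 (this h1)
  have hr := hq.rotate hu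
  have hsupp : ∀ z ∈ (q.rotate u hu).support, z ∈ q.support := fun z hz => by simpa using hz
  generalize q.rotate u hu = r at hr hsupp
  cases r with
  | nil => exact absurd rfl hr.ne_nil
  | @cons _ x _ hux r =>
    obtain ⟨hpath, hedge⟩ := (SimpleGraph.Walk.cons_isCycle_iff r hux).1 hr
    -- Reversing the rest of the cycle exposes the edge by which the cycle returns to `u`.
    obtain ⟨r', rfl⟩ : ∃ r' : G.Walk u x, r = r'.reverse := ⟨r.reverse, by simp⟩
    rw [SimpleGraph.Walk.isPath_reverse_iff] at hpath
    cases r' with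
    | nil => exact absurd rfl hux.ne
    | @cons _ z _ huz p =>
      rw [SimpleGraph.Walk.cons_isPath_iff] at hpath
      have hps : ∀ y ∈ p.support, y ≠ u ∧ y ∈ q.support := fun y hy =>
        ⟨fun h => hpath.2 (h ▸ hy), hsupp y (by simp [hy])⟩
      have hzx : z ≠ x := by
        rintro rfl
        simp at hedge
      have hcu := hcol u hu
      have hcz := hcol z (hps z p.start_mem_support).2
      have hcx := hcol x (hps x p.end_mem_support).2
      have hzu := (hps z p.start_mem_support).1
      have hxu := (hps x p.end_mem_support).1
      have hza := ha z huz
      have hxa := ha x hux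
      have hzx' : c z = c x := by
        simp only [Function.update_self, Function.update_of_ne hzu,
          Function.update_of_ne hxu] at hcu hcz hcx
        exact eq_of_ne_of_two_colors hcu hcz hcx hza.symm hxa.symm
      have halt : ∀ t ≤ p.length, c (p.getVert t) = if Even t then c z else a := by
        intro t ht
        refine color_getVert_of_two_colors hc.1 p (fun y hy => ?_) rfl ht
        have h1 := hcol y (hps y hy).2
        simp only [Function.update_self, Function.update_of_ne hzu,
          Function.update_of_ne (hps y hy).1] at hcu hcz h1
        exact or_iff_not_imp_left.2 fun hya =>
          eq_of_ne_of_two_colors hcu h1 hcz (Ne.symm hya) hza.symm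
      refine ⟨z, x, p, hpath.1, ?_, hpath.2, hzx, huz, hux, hzx', halt⟩
      -- On a path of odd length the last vertex, a neighbor of `u`, would have the color `a`.
      by_contra hodd
      have := halt p.length le_rfl
      rw [if_neg hodd, SimpleGraph.Walk.getVert_length] at this
      exact hxa this

end Colorings

/-! ### Bounds for the acyclic degree -/

section AcyclicDegree

variable {V : Type*} {G : SimpleGraph V} {v : V} {A₀ : Finset V} {parts : Finset (Finset V)}

theorem LinkingPath.one_lt_length (p : LinkingPath G v parts) : 1 < p.walk.length := by
  have h := p.even_length
  have h0 : p.walk.length ≠ 0 := fun h0 => p.ne (SimpleGraph.Walk.eq_of_length_eq_zero h0)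
  obtain ⟨k, hk⟩ := h
  omega

/-- The first edge (for `true`) or the last edge (for `false`) of a linking path, directed away
from the neighborhood of `v`. -/
def LinkingPath.endDart (p : LinkingPath G v parts) : Bool → V × V
  | true => (p.fst, p.walk.getVert 1)
  | false => (p.lst, p.walk.getVert (p.walk.length - 1))

theorem LinkingPath.endDart_fst_mem (p : LinkingPath G v parts) (b : Bool) :
    ∃ A ∈ parts, (p.endDart b).1 ∈ A := by
  obtain ⟨A, hA, h1, h2⟩ := p.same_part
  cases b
  exacts [⟨A, hA, h2⟩, ⟨A, hA, h1⟩]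

theorem LinkingPath.endDart_adj (p : LinkingPath G v parts) (b : Bool) :
    G.Adj (p.endDart b).1 (p.endDart b).2 := by
  have hl := p.one_lt_length
  cases b
  · have h := p.walk.adj_getVert_succ (i := p.walk.length - 1) (by omega)
    rw [show p.walk.length - 1 + 1 = p.walk.length by omega,
      SimpleGraph.Walk.getVert_length] at h
    exact h.symm
  · simpa [LinkingPath.endDart] using p.walk.adj_getVert_succ (i := 0) (by omega)

theorem LinkingPath.endDart_snd_mem_evenVertices (p : LinkingPath G v parts) (b : Bool) :
    (p.endDart b).2 ∈ evenVertices p.walk := by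
  have hl := p.one_lt_length
  cases b
  · exact ⟨p.walk.length - 1, Nat.Even.sub_odd (by omega) p.even_length odd_one, by omega, rfl⟩
  · exact ⟨1, odd_one, by omega, rfl⟩

theorem LinkingPath.endDart_snd_mem_support (p : LinkingPath G v parts) (b : Bool) :
    (p.endDart b).2 ∈ p.walk.support := by
  cases b <;> exact p.walk.getVert_mem_support _

theorem LinkingPath.endDart_snd_ne (p : LinkingPath G v parts) (b : Bool) :
    (p.endDart b).2 ≠ v := by
  intro h
  have := p.endDart_snd_mem_support b
  rw [h] at this
  exact p.avoids this

/-- The first and the last edges of EVI disjoint paths are different edges. -/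
theorem endDart_injective {m : ℕ} {p : Fin m → LinkingPath G v parts}
    (hp : ∀ s t, s ≠ t → EVIDisjoint (p s).walk (p t).walk) :
    Function.Injective fun sb : Fin m × Bool => (p sb.1).endDart sb.2 := by
  rintro ⟨s, b⟩ ⟨t, b'⟩ h
  simp only at h
  obtain rfl : s = t := by
    by_contra hst
    refine (hp s t hst _ ((p s).endDart_snd_mem_support b) ?_).1
      ((p s).endDart_snd_mem_evenVertices b)
    rw [h]
    exact (p t).endDart_snd_mem_support b'
  have hne := (p s).ne
  cases b <;> cases b' <;> simp_all [LinkingPath.endDart]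

theorem IsWeakPartition.two_mul_card_le [DecidableEq V]
    (hP : IsWeakPartition G v A₀ parts) :
    2 * parts.card ≤ (parts.biUnion id).card := by
  have h : (parts.biUnion id).card = ∑ A ∈ parts, A.card :=
    Finset.card_biUnion fun A hA B hB h => hP.disjoint_parts A hA B hB h
  rw [h, mul_comm, ← smul_eq_mul]
  exact Finset.card_nsmul_le_sum _ _ _ hP.two_le

section Bounds

variable [Fintype V] [DecidableEq V] [DecidableRel G.Adj] {D : ℕ}

/-- Each of the paths uses two of the at most `D` edges that lead from a neighbor of `v` to a vertex
other than `v`. -/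
theorem two_mul_card_linkingPaths_le (hP : IsWeakPartition G v A₀ parts)
    (hD : ∀ w, G.degree w ≤ D + 1) {m : ℕ} {p : Fin m → LinkingPath G v parts}
    (hp : ∀ s t, s ≠ t → EVIDisjoint (p s).walk (p t).walk) :
    2 * m ≤ D * (parts.biUnion id).card := by
  set U := parts.biUnion id with hU
  set E : Finset (Σ _ : V, V) := U.sigma fun x => (G.neighborFinset x).erase v with hE
  have hcard : E.card ≤ D * U.card := by
    rw [hE, Finset.card_sigma, mul_comm, ← smul_eq_mul]
    refine Finset.sum_le_card_nsmul _ _ _ fun x hx => ?_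
    obtain ⟨A, hA, hxA⟩ := Finset.mem_biUnion.1 hx
    have hvx : G.Adj v x := (hP.cover x).2 (Or.inr ⟨A, hA, hxA⟩)
    rw [Finset.card_erase_of_mem (by simpa using hvx.symm),
      SimpleGraph.card_neighborFinset_eq_degree]
    have := hD x
    omega
  refine le_trans ?_ hcard
  have hinj := endDart_injective hp
  calc 2 * m = (Finset.univ : Finset (Fin m × Bool)).card := by simp [mul_comm]
    _ ≤ E.card := by
      refine Finset.card_le_card_of_injOn
        (fun sb => ⟨((p sb.1).endDart sb.2).1, ((p sb.1).endDart sb.2).2⟩) ?_ ?_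
      · rintro ⟨s, b⟩ -
        obtain ⟨A, hA, h⟩ := (p s).endDart_fst_mem b
        simpa [hE, hU] using
          ⟨⟨A, hA, h⟩, (p s).endDart_adj b, (p s).endDart_snd_ne b⟩
      · intro x _ y _ h
        simp only [Sigma.mk.injEq, heq_eq_eq] at h
        exact hinj (Prod.ext h.1 h.2)

theorem IsWeakPartition.card_add_card_biUnion_le (hP : IsWeakPartition G v A₀ parts) :
    A₀.card + (parts.biUnion id).card ≤ G.degree v := by
  rw [← Finset.card_union_of_disjoint, ← SimpleGraph.card_neighborFinset_eq_degree]
  · refine Finset.card_le_card fun z hz => ?_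
    rw [SimpleGraph.mem_neighborFinset, hP.cover]
    simpa using hz
  · rw [Finset.disjoint_biUnion_right]
    exact hP.disjoint_zero

theorem bddAbove_linkingPaths (hP : IsWeakPartition G v A₀ parts) :
    BddAbove {m | ∃ p : Fin m → LinkingPath G v parts,
      ∀ s t, s ≠ t → EVIDisjoint (p s).walk (p t).walk} := by
  refine ⟨G.maxDegree * (parts.biUnion id).card, ?_⟩
  rintro m ⟨p, hp⟩
  have := two_mul_card_linkingPaths_le (D := G.maxDegree) hP
    (fun w => (G.degree_le_maxDegree w).trans (by omega)) hp
  omega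

theorem le_elp (hP : IsWeakPartition G v A₀ parts) {m : ℕ} {p : Fin m → LinkingPath G v parts}
    (hp : ∀ s t, s ≠ t → EVIDisjoint (p s).walk (p t).walk) : m ≤ elp G v parts :=
  le_csSup (bddAbove_linkingPaths hP) ⟨p, hp⟩

theorem two_mul_elp_le (hP : IsWeakPartition G v A₀ parts) (hD : ∀ w, G.degree w ≤ D + 1) :
    2 * elp G v parts ≤ D * (parts.biUnion id).card := by
  obtain ⟨p, hp⟩ := Nat.sSup_mem
    (s := {m | ∃ p : Fin m → LinkingPath G v parts,
      ∀ s t, s ≠ t → EVIDisjoint (p s).walk (p t).walk})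
    ⟨0, fun s => s.elim0, fun s => s.elim0⟩ (bddAbove_linkingPaths hP)
  exact two_mul_card_linkingPaths_le hP hD hp

/-- With `S` neighbors of `v` in the parts, there are at most `S / 2` parts and at most
`(D - 1) * S / 2` paths. -/
theorem IsWeakPartition.two_mul_add_le (hP : IsWeakPartition G v A₀ parts) (h2 : 2 ≤ D)
    (hD : ∀ w, G.degree w ≤ D) : 2 * (A₀.card + parts.card + elp G v parts) ≤ D ^ 2 := by
  obtain ⟨E, rfl⟩ : ∃ E, D = E + 1 := ⟨D - 1, by omega⟩
  have h3 := two_mul_elp_le hP hD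
  have h4 := hP.two_mul_card_le
  have h5 := hP.card_add_card_biUnion_le.trans (hD v)
  generalize (parts.biUnion id).card = S at *
  calc 2 * (A₀.card + parts.card + elp G v parts) ≤ 2 * A₀.card + (E + 1) * S := by linarith
    _ ≤ (E + 1) * A₀.card + (E + 1) * S := by gcongr
    _ = (E + 1) * (A₀.card + S) := by ring
    _ ≤ (E + 1) ^ 2 := by rw [sq]; gcongr

theorem two_mul_acyclicDegree_le (h2 : 2 ≤ D) (hD : ∀ w, G.degree w ≤ D) (v : V) :
    2 * acyclicDegree G v ≤ D ^ 2 := by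
  suffices acyclicDegree G v ≤ D ^ 2 / 2 by omega
  refine csSup_le' ?_
  rintro d ⟨A₀, parts, hP, rfl⟩
  have := hP.two_mul_add_le h2 hD
  omega

theorem IsWeakPartition.le_acyclicDegree (hP : IsWeakPartition G v A₀ parts) :
    A₀.card + parts.card + elp G v parts ≤ acyclicDegree G v := by
  refine le_csSup ⟨(G.maxDegree + 2) ^ 2, ?_⟩ ⟨A₀, parts, hP, rfl⟩
  rintro d ⟨A₀, parts, hP, rfl⟩
  have := hP.two_mul_add_le (D := G.maxDegree + 2) (by omega)
    fun w => (G.degree_le_maxDegree w).trans (by omega)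
  omega

end Bounds

/-- A vertex `u` of an acyclic coloring that cannot be recolored on its own with any color of `C`
has acyclic degree at least `|C| - 1`.  The partition of the neighborhood is the one into color
classes; a color of `C` that is neither the color of `u` nor a color of a neighbor of `u` provides
a linking path whose even vertices are the vertices of that color. -/
theorem card_le_acyclicDegree_add_one [Fintype V] [DecidableEq V] {α : Type*} [DecidableEq α]
    {c : V → α} (hc : IsAcyclicColoring G c) (u : V) (C : Finset α)
    (hC : ∀ a ∈ C, a ≠ c u → (∀ w, G.Adj u w → c w ≠ a) →
      ¬ IsAcyclicColoring G (Function.update c u a)) :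
    C.card ≤ acyclicDegree G u + 1 := by
  classical
  set nbrs : Finset V := G.neighborFinset u
  have hnbrs : ∀ w, w ∈ nbrs ↔ G.Adj u w := fun w => by simp [nbrs]
  set cls : α → Finset V := fun b => nbrs.filter fun w => c w = b with hcls
  -- `B` consists of the colors of the neighbors, `B₁` of those that occur once, and `T` of the
  -- colors of `C` that are missing in the closed neighborhood of `u`.
  set B : Finset α := nbrs.image c with hB
  set B₁ : Finset α := B.filter fun b => (cls b).card = 1 with hB₁
  set B₂ : Finset α := B.filter fun b => ¬ (cls b).card = 1 with hB₂
  set A₀ : Finset V := nbrs.filter fun w => (cls (c w)).card = 1 with hA₀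
  set parts : Finset (Finset V) := B₂.image cls with hparts
  have hcolor : ∀ b, ∀ z ∈ cls b, c z = b := fun b z hz => (Finset.mem_filter.1 hz).2
  have hpos : ∀ b ∈ B, (cls b).Nonempty := by
    intro b hb
    obtain ⟨w, hw, rfl⟩ := Finset.mem_image.1 hb
    exact ⟨w, Finset.mem_filter.2 ⟨hw, rfl⟩⟩
  have hdisj : ∀ b b', b ≠ b' → Disjoint (cls b) (cls b') := fun b b' hbb' =>
    Finset.disjoint_left.2 fun z hz hz' => hbb' ((hcolor _ _ hz).symm.trans (hcolor _ _ hz'))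
  have hP : IsWeakPartition G u A₀ parts := by
    refine ⟨?_, ?_, ?_, ?_⟩
    · intro A hA
      obtain ⟨b, hb, rfl⟩ := Finset.mem_image.1 hA
      rw [hB₂, Finset.mem_filter] at hb
      have := (hpos b hb.1).card_pos
      omega
    · intro A hA
      obtain ⟨b, hb, rfl⟩ := Finset.mem_image.1 hA
      rw [hB₂, Finset.mem_filter] at hb
      refine Finset.disjoint_left.2 fun z hz hz' => hb.2 ?_
      rw [← hcolor _ _ hz']
      exact (Finset.mem_filter.1 hz).2
    · intro A hA A' hA' hne
      obtain ⟨b, hb, rfl⟩ := Finset.mem_image.1 hA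
      obtain ⟨b', hb', rfl⟩ := Finset.mem_image.1 hA'
      exact hdisj _ _ fun h => hne (h ▸ rfl)
    · intro z
      rw [← hnbrs]
      constructor
      · intro hz
        by_cases h : (cls (c z)).card = 1
        · exact Or.inl (Finset.mem_filter.2 ⟨hz, h⟩)
        · exact Or.inr ⟨cls (c z), Finset.mem_image_of_mem _ (Finset.mem_filter.2
            ⟨Finset.mem_image_of_mem _ hz, h⟩), Finset.mem_filter.2 ⟨hz, rfl⟩⟩
      · rintro (hz | ⟨A, hA, hz⟩)
        · exact (Finset.mem_filter.1 hz).1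
        · obtain ⟨b, -, rfl⟩ := Finset.mem_image.1 hA
          exact (Finset.mem_filter.1 hz).1
  have hcardB : B.card ≤ A₀.card + parts.card := by
    have h1 : B₁.card ≤ A₀.card := by
      refine (Finset.card_le_card (t := A₀.image c) fun b hb => ?_).trans Finset.card_image_le
      rw [hB₁, Finset.mem_filter] at hb
      obtain ⟨w, hw, rfl⟩ := Finset.mem_image.1 hb.1
      exact Finset.mem_image_of_mem _ (Finset.mem_filter.2 ⟨hw, hb.2⟩)
    have h2 : parts.card = B₂.card := by
      refine Finset.card_image_of_injOn fun b hb b' hb' h => ?_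
      obtain ⟨z, hz⟩ := hpos b (Finset.mem_filter.1 hb).1
      have hz' : z ∈ cls b' := by simpa only [← h] using hz
      exact (hcolor _ _ hz).symm.trans (hcolor _ _ hz')
    have h3 : B₁.card + B₂.card = B.card := Finset.card_filter_add_card_filter_not _
    omega
  set T : Finset α := (C.erase (c u)) \ B with hT
  have hTcard : C.card ≤ 1 + B.card + T.card := by
    have h1 := Finset.pred_card_le_card_erase (s := C) (a := c u)
    have h2 : (C.erase (c u)).card - B.card ≤ T.card := Finset.le_card_sdiff B (C.erase (c u))
    omega
  have hpath : ∀ a ∈ T, ∃ p : LinkingPath G u parts, ∀ t ≤ p.walk.length,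
      (Even t → c (p.walk.getVert t) ∈ B) ∧ (Odd t → c (p.walk.getVert t) = a) := by
    intro a ha
    obtain ⟨⟨hau, haC⟩, haB⟩ : (a ≠ c u ∧ a ∈ C) ∧ a ∉ B := by simpa [hT] using ha
    have haN : ∀ w, G.Adj u w → c w ≠ a := fun w hw h =>
      haB (h ▸ Finset.mem_image_of_mem _ ((hnbrs w).2 hw))
    have hna := hC a haC hau haN
    obtain ⟨x, z, p, hp, heven, hup, hxz, hux, huz, hcxz, halt⟩ :=
      exists_path_of_not_isAcyclicColoring_update hc haN (by convert hna)
    have hxB : c x ∈ B := Finset.mem_image_of_mem _ ((hnbrs x).2 hux)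
    have hx : x ∈ cls (c x) := Finset.mem_filter.2 ⟨(hnbrs x).2 hux, rfl⟩
    have hz : z ∈ cls (c x) := Finset.mem_filter.2 ⟨(hnbrs z).2 huz, hcxz.symm⟩
    refine ⟨⟨x, z, p, hp, heven, hup, hxz, cls (c x), Finset.mem_image_of_mem _
      (Finset.mem_filter.2 ⟨hxB, ?_⟩), hx, hz⟩, fun t ht => ⟨fun h => ?_, fun h => ?_⟩⟩
    · exact (Finset.one_lt_card.2 ⟨x, hx, z, hz, hxz⟩).ne'
    · have := halt t ht
      rw [if_pos h] at this
      rwa [this]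
    · have := halt t ht
      rwa [if_neg (Nat.not_even_iff_odd.2 h)] at this
  choose p hp using fun a : T => hpath a a.2
  -- A vertex of one path that is an even vertex of another one would have the color of the other
  -- path, which is neither a color of a neighbor of `u` nor the color of the first path.
  have hevi : ∀ a b : T, a ≠ b → ∀ z ∈ (p a).walk.support, z ∉ evenVertices (p b).walk := by
    rintro a b hab z hz ⟨t, ht, htl, rfl⟩
    obtain ⟨s, hs, hsl⟩ := SimpleGraph.Walk.mem_support_iff_exists_getVert.1 hz
    have h1 := (hp b t htl).2 ht
    rw [← hs] at h1
    rcases Nat.even_or_odd s with h | h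
    · have := (hp a s hsl).1 h
      rw [h1] at this
      exact (Finset.mem_sdiff.1 b.2).2 this
    · exact hab (Subtype.ext (((hp a s hsl).2 h).symm.trans h1))
  have help : T.card ≤ elp G u parts := by
    refine le_elp hP (p := fun s => p (T.equivFin.symm s)) fun s t hst z hs ht => ?_
    have hne := T.equivFin.symm.injective.ne hst
    exact ⟨hevi _ _ hne.symm z ht, hevi _ _ hne z hs⟩
  have := hP.le_acyclicDegree
  omega

end AcyclicDegree

/-! ### The acyclic b-chromatic number is at most the `m_a`-degree -/

section MaDegree

variable {V : Type*} [Fintype V] {G : SimpleGraph V}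

/-- In a minimal acyclic coloring with `k` colors every color class contains a vertex of acyclic
degree at least `k - 1`.  Otherwise the vertices of the class could be recolored one after the
other. -/
theorem IsMinimalAcyclicColoring.exists_numColors_le {α : Type*} {c : V → α}
    (hc : IsMinimalAcyclicColoring G c) {i : α} (hi : i ∈ Set.range c) :
    ∃ u, c u = i ∧ numColors c ≤ acyclicDegree G u + 1 := by
  classical
  by_contra! hcon
  have hnum : numColors c = (Finset.univ.image c).card := by
    rw [numColors, ← Set.ncard_coe_finset]
    simp
  have key : ∀ S : Finset V, (∀ u ∈ S, c u = i) → ∃ c' : V → α, IsAcyclicColoring G c' ∧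
      (∀ u ∉ S, c' u = c u) ∧
      ∀ u ∈ S, c' u ∈ Set.range c ∧ c' u ≠ c u ∧ ∀ w, G.Adj u w → c' u ≠ c w := by
    intro S
    induction S using Finset.induction_on with
    | empty => exact fun _ => ⟨c, hc.1, fun _ _ => rfl, fun u hu => by simp at hu⟩
    | insert u S hu ih =>
      intro hS
      obtain ⟨c', hc', hout, hin⟩ := ih fun w hw => hS w (Finset.mem_insert_of_mem hw)
      have hcu := hS u (Finset.mem_insert_self _ _)
      -- A color class is independent, so the neighbors of `u` still have their old colors.
      have hN : ∀ w, G.Adj u w → c' w = c w := fun w hw => hout w fun hwS =>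
        hc.1.1 u w hw (hcu.trans (hS w (Finset.mem_insert_of_mem hwS)).symm)
      obtain ⟨a, ha, hau, haN, hac⟩ : ∃ a ∈ Finset.univ.image c, a ≠ c' u ∧
          (∀ w, G.Adj u w → c' w ≠ a) ∧ IsAcyclicColoring G (Function.update c' u a) := by
        by_contra! hno
        have h1 := card_le_acyclicDegree_add_one hc' u (Finset.univ.image c) hno
        have h2 := hcon u hcu
        omega
      refine ⟨Function.update c' u a, hac, fun w hw => ?_, fun w hw => ?_⟩
      · rw [Finset.mem_insert, not_or] at hw
        rw [Function.update_of_ne hw.1, hout w hw.2]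
      · by_cases hwu : w = u
        · subst hwu
          rw [Function.update_self]
          refine ⟨by simpa using ha, ?_, fun z hz => ?_⟩
          · rwa [← hout w hu]
          · rw [← hN z hz]
            exact (haN z hz).symm
        · rw [Function.update_of_ne hwu]
          exact hin w ((Finset.mem_insert.1 hw).resolve_left hwu)
  obtain ⟨c', hc', hout, hin⟩ := key (Finset.univ.filter fun u => c u = i) (by simp)
  refine hc.2 c' (Relation.TransGen.single ⟨hc.1, hc', i, hi, fun u hu => hout u (by simpa),
    fun u hu => hin u (by simpa)⟩)

/-- If `k` vertices have acyclic degree at least `k - 1`, then so does the vertex at position `k` of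
an ordering by non-increasing acyclic degree. -/
theorem le_maDegree_of_le_acyclicDegree {k : ℕ} {S : Finset V} (hS : k ≤ S.card)
    (h : ∀ u ∈ S, k ≤ acyclicDegree G u + 1) : k ≤ maDegree G := by
  classical
  rcases Nat.eq_zero_or_pos k with rfl | hk
  · exact Nat.zero_le _
  have hcard : k ≤ Fintype.card V := hS.trans (Finset.card_le_univ S)
  let e₀ := (Fintype.equivFin V).symm
  let σ := Tuple.sort fun r => OrderDual.toDual (acyclicDegree G (e₀ r))
  have hanti : Antitone fun r => acyclicDegree G ((σ.trans e₀) r) := fun r s hrs =>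
    OrderDual.toDual_le_toDual.1
      (Tuple.monotone_sort (fun r => OrderDual.toDual (acyclicDegree G (e₀ r))) hrs)
  refine le_csSup ⟨Fintype.card V, ?_⟩
    ⟨σ.trans e₀, hanti, ⟨k - 1, by omega⟩, by simp; omega, ?_⟩
  · rintro _ ⟨e, -, r, rfl, -⟩
    exact r.2
  · rw [← Tuple.lt_card_ge_iff_apply_ge_of_antitone hanti]
    simp only
    have hle : S.card ≤ (Finset.univ.filter fun r =>
        k - 1 ≤ acyclicDegree G ((σ.trans e₀) r)).card := by
      refine Finset.card_le_card_of_injOn (σ.trans e₀).symm (fun u hu => ?_)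
        (σ.trans e₀).symm.injective.injOn
      have := h u hu
      simp only [Finset.coe_filter, Finset.mem_univ, true_and, Set.mem_ofPred_eq,
        Equiv.apply_symm_apply]
      omega
    omega

theorem IsMinimalAcyclicColoring.numColors_le_maDegree {α : Type*} {c : V → α}
    (hc : IsMinimalAcyclicColoring G c) : numColors c ≤ maDegree G := by
  classical
  rcases isEmpty_or_nonempty V with hV | hV
  · simp [numColors, Set.range_eq_empty]
  choose! f hf using fun i (hi : i ∈ Set.range c) => hc.exists_numColors_le hi
  refine le_maDegree_of_le_acyclicDegree (S := (Finset.univ.image c).image f) ?_ fun u hu => ?_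
  · rw [Finset.card_image_of_injOn, numColors, ← Set.ncard_coe_finset]
    · simp
    · intro i hi j hj h
      rw [← (hf i (by simpa using hi)).1, h, (hf j (by simpa using hj)).1]
  · obtain ⟨i, hi, rfl⟩ := Finset.mem_image.1 hu
    exact (hf i (by simpa using hi)).2

theorem bddAbove_numColors : BddAbove {k | ∃ c : V → ℕ,
    IsMinimalAcyclicColoring G c ∧ numColors c = k} := by
  refine ⟨maDegree G, ?_⟩
  rintro _ ⟨c, hc, rfl⟩
  exact hc.numColors_le_maDegree

theorem acyclicBChromaticNumber_le_maDegree : acyclicBChromaticNumber G ≤ maDegree G := by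
  refine csSup_le' ?_
  rintro _ ⟨c, hc, rfl⟩
  exact hc.numColors_le_maDegree

theorem two_mul_maDegree_le [DecidableRel G.Adj] {D : ℕ} (h2 : 2 ≤ D)
    (hD : ∀ w, G.degree w ≤ D) : 2 * maDegree G ≤ D ^ 2 + 2 := by
  classical
  suffices maDegree G ≤ D ^ 2 / 2 + 1 by omega
  refine csSup_le' ?_
  rintro _ ⟨e, -, r, rfl, hr⟩
  have := two_mul_acyclicDegree_le h2 hD (e r)
  omega

end MaDegree

/-! ### The structure of the chains of gadgets -/

section Chain

variable {n M : ℕ}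

theorem gadget_adj_x_iff {j : Fin (2 * n)} {b : GadgetVertex n} : (gadget n).Adj (.x j) b ↔
    b = .v ∨ ∃ k : Fin (n * (2 * n - 1)), (k : ℕ) / (2 * n - 1) = (j : ℕ) / 2 ∧ b = .y k := by
  cases b <;> simp [gadget, SimpleGraph.fromRel_adj, eq_comm]

theorem gadget_adj_exists_x {a b : GadgetVertex n} (h : (gadget n).Adj a b) :
    (∃ j, a = .x j) ∨ ∃ j, b = .x j := by
  cases a <;> cases b <;> simp_all [gadget, SimpleGraph.fromRel_adj]

theorem inCopy_injective (i : Fin M) : Function.Injective (inCopy (n := n) i) := by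
  intro a b h
  cases a <;> cases b <;> simp_all [inCopy, Fin.ext_iff]

theorem gadgetChain_adj_iff {a b : ChainVertex n M} : (gadgetChain n M).Adj a b ↔
    ∃ (i : Fin M) (a' b' : GadgetVertex n),
      (gadget n).Adj a' b' ∧ inCopy i a' = a ∧ inCopy i b' = b := by
  simp only [gadgetChain, SimpleGraph.iSup_adj, SimpleGraph.map_adj']
  refine exists_congr fun i => ⟨fun h => h.2, fun h => ⟨?_, h⟩⟩
  obtain ⟨a', b', h, rfl, rfl⟩ := h
  exact (inCopy_injective i).ne h.ne

theorem gadgetChain_adj_x_iff {i : Fin M} {j : Fin (2 * n)} {b : ChainVertex n M} :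
    (gadgetChain n M).Adj (.x i j) b ↔ b = .v i ∨
      ∃ k : Fin (n * (2 * n - 1)), (k : ℕ) / (2 * n - 1) = (j : ℕ) / 2 ∧ b = inCopy i (.y k) := by
  rw [gadgetChain_adj_iff]
  constructor
  · rintro ⟨i', a', b', h, h1, rfl⟩
    cases a' with
    | v => simp [inCopy] at h1
    | y k => simp [inCopy] at h1
    | x j' =>
      simp only [inCopy, ChainVertex.x.injEq] at h1
      obtain ⟨rfl, rfl⟩ := h1
      rcases gadget_adj_x_iff.1 h with rfl | ⟨k, hk, rfl⟩
      · exact Or.inl rfl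
      · exact Or.inr ⟨k, hk, rfl⟩
  · rintro (rfl | ⟨k, hk, rfl⟩)
    · exact ⟨i, .x j, .v, gadget_adj_x_iff.2 (Or.inl rfl), rfl, rfl⟩
    · exact ⟨i, .x j, .y k, gadget_adj_x_iff.2 (Or.inr ⟨k, hk, rfl⟩), rfl, rfl⟩

theorem gadgetChain_adj_exists_x {a b : ChainVertex n M} (h : (gadgetChain n M).Adj a b) :
    (∃ i j, a = .x i j) ∨ ∃ i j, b = .x i j := by
  obtain ⟨i, a', b', hab, rfl, rfl⟩ := gadgetChain_adj_iff.1 h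
  rcases gadget_adj_exists_x hab with ⟨j, rfl⟩ | ⟨j, rfl⟩
  exacts [Or.inl ⟨i, j, rfl⟩, Or.inr ⟨i, j, rfl⟩]

theorem gadgetChain_adj_v_x (i : Fin M) (j : Fin (2 * n)) :
    (gadgetChain n M).Adj (.v i) (.x i j) :=
  (gadgetChain_adj_x_iff.2 (Or.inl rfl)).symm

theorem eq_x_of_gadgetChain_adj_v {i : Fin M} {b : ChainVertex n M}
    (h : (gadgetChain n M).Adj (.v i) b) : ∃ j, b = .x i j := by
  rcases gadgetChain_adj_exists_x h with ⟨_, _, h'⟩ | ⟨i', j, rfl⟩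
  · cases h'
  · rcases gadgetChain_adj_x_iff.1 h.symm with h' | ⟨k, -, h'⟩
    · cases h'
      exact ⟨j, rfl⟩
    · cases h'

theorem eq_x_of_gadgetChain_adj_y {p : Fin (M * (n * (2 * n - 1) - 1) + 1)} {b : ChainVertex n M}
    (h : (gadgetChain n M).Adj (.y p) b) : ∃ i j, b = .x i j ∧ ∃ k : Fin (n * (2 * n - 1)),
      (k : ℕ) / (2 * n - 1) = (j : ℕ) / 2 ∧ (p : ℕ) = i * (n * (2 * n - 1) - 1) + k := by
  rcases gadgetChain_adj_exists_x h with ⟨_, _, h'⟩ | ⟨i', j, rfl⟩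
  · cases h'
  · rcases gadgetChain_adj_x_iff.1 h.symm with h' | ⟨k, hk, h'⟩
    · cases h'
    · simp only [inCopy, ChainVertex.y.injEq, Fin.ext_iff] at h'
      exact ⟨i', j, rfl, k, hk, h'⟩

/-- Two gadgets that share a vertex `y` do so in blocks of different numbers: the shared vertex is
in the last block of the one and in the first block of the other, and there are at least two
blocks. -/
theorem gadget_index_eq_of_block_eq (h2 : 2 ≤ n) {i i' k k' : ℕ} (hk : k < n * (2 * n - 1))
    (heq : i * (n * (2 * n - 1) - 1) + k = i' * (n * (2 * n - 1) - 1) + k')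
    (hb : k / (2 * n - 1) = k' / (2 * n - 1)) : i' ≤ i := by
  by_contra! hlt
  have h1 : (i + 1) * (n * (2 * n - 1) - 1) ≤ i' * (n * (2 * n - 1) - 1) :=
    Nat.mul_le_mul_right _ hlt
  have h3 : (i + 1) * (n * (2 * n - 1) - 1) =
    i * (n * (2 * n - 1) - 1) + (n * (2 * n - 1) - 1) := by ring
  have h4 : 2 * (2 * n - 1) ≤ n * (2 * n - 1) := Nat.mul_le_mul_right _ h2
  have hk' : k' = 0 := by omega
  rw [hk', Nat.zero_div, Nat.div_eq_zero_iff] at hb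
  omega

/-- If all the neighbors of a vertex are vertices `x`, and different ones have different numbers
within their gadgets, then the degree is at most `2n`. -/
theorem degree_le_of_forall_eq_x {u : ChainVertex n M}
    (hx : ∀ b, (gadgetChain n M).Adj u b → ∃ i j, b = .x i j)
    (hinj : ∀ i i' j, (gadgetChain n M).Adj u (.x i j) → (gadgetChain n M).Adj u (.x i' j) →
      i = i') : (gadgetChain n M).degree u ≤ 2 * n := by
  classical
  rw [← SimpleGraph.card_neighborFinset_eq_degree]
  conv_rhs => rw [← Finset.card_range (2 * n)]
  let f : ChainVertex n M → ℕ := fun b => match b with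
    | .x _ j => j
    | _ => 0
  refine Finset.card_le_card_of_injOn f (fun b hb => ?_) fun b hb b' hb' h => ?_
  · obtain ⟨i, j, rfl⟩ := hx b (by simpa using hb)
    simp [f]
  · have hb : (gadgetChain n M).Adj u b := by simpa using hb
    have hb' : (gadgetChain n M).Adj u b' := by simpa using hb'
    obtain ⟨i, j, rfl⟩ := hx b hb
    obtain ⟨i', j', rfl⟩ := hx b' hb'
    obtain rfl : j = j' := Fin.ext h
    rw [hinj i i' j hb hb']

theorem gadgetChain_degree_le (hn : 1 ≤ n) (hM : 2 ≤ n ∨ M = 1) (u : ChainVertex n M) :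
    (gadgetChain n M).degree u ≤ 2 * n := by
  classical
  cases u with
  | v i =>
    refine degree_le_of_forall_eq_x (fun b hb => ?_) fun i₁ i₂ j h₁ h₂ => ?_
    · obtain ⟨j, rfl⟩ := eq_x_of_gadgetChain_adj_v hb
      exact ⟨i, j, rfl⟩
    · obtain ⟨_, h₁⟩ := eq_x_of_gadgetChain_adj_v h₁
      obtain ⟨_, h₂⟩ := eq_x_of_gadgetChain_adj_v h₂
      cases h₁
      cases h₂
      rfl
  | y p =>
    refine degree_le_of_forall_eq_x (fun b hb => ?_) fun i₁ i₂ j h₁ h₂ => ?_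
    · obtain ⟨i, j, rfl, -⟩ := eq_x_of_gadgetChain_adj_y hb
      exact ⟨i, j, rfl⟩
    · rcases hM with h2 | rfl
      · obtain ⟨_, _, h₁, k₁, hk₁, e₁⟩ := eq_x_of_gadgetChain_adj_y h₁
        obtain ⟨_, _, h₂, k₂, hk₂, e₂⟩ := eq_x_of_gadgetChain_adj_y h₂
        cases h₁
        cases h₂
        exact Fin.ext (le_antisymm
          (gadget_index_eq_of_block_eq h2 k₂.2 (e₂.symm.trans e₁) (hk₂.trans hk₁.symm))
          (gadget_index_eq_of_block_eq h2 k₁.2 (e₁.symm.trans e₂) (hk₁.trans hk₂.symm)))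
      · exact Subsingleton.elim _ _
  | x i j =>
    -- The `y`-neighbors form one block, in which `k % (2n - 1)` determines `k`.
    set S : Finset (Fin (n * (2 * n - 1))) :=
      Finset.univ.filter fun k => (k : ℕ) / (2 * n - 1) = (j : ℕ) / 2 with hS
    have hcard : S.card ≤ 2 * n - 1 := by
      conv_rhs => rw [← Finset.card_range (2 * n - 1)]
      refine Finset.card_le_card_of_injOn (fun k => (k : ℕ) % (2 * n - 1)) (fun k _ => ?_)
        fun k hk k' hk' h => ?_
      · simpa using Nat.mod_lt _ (by omega : 0 < 2 * n - 1)
      · have hk : (k : ℕ) / (2 * n - 1) = (j : ℕ) / 2 := by simpa [hS] using hk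
        have hk' : (k' : ℕ) / (2 * n - 1) = (j : ℕ) / 2 := by simpa [hS] using hk'
        refine Fin.ext ?_
        rw [← Nat.div_add_mod (k : ℕ) (2 * n - 1), ← Nat.div_add_mod (k' : ℕ) (2 * n - 1), hk, hk']
        exact congrArg _ h
    have hsub : (gadgetChain n M).neighborFinset (.x i j) ⊆
        insert (.v i) (S.image fun k => inCopy i (.y k)) := by
      intro b hb
      rw [SimpleGraph.mem_neighborFinset, gadgetChain_adj_x_iff] at hb
      rcases hb with rfl | ⟨k, hk, rfl⟩
      · exact Finset.mem_insert_self _ _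
      · exact Finset.mem_insert_of_mem (Finset.mem_image_of_mem _ (by simpa [hS] using hk))
    rw [← SimpleGraph.card_neighborFinset_eq_degree]
    have h1 := Finset.card_le_card hsub
    have h2 := Finset.card_insert_le (ChainVertex.v i : ChainVertex n M)
      (S.image fun k => inCopy i (.y k))
    have h3 : (S.image fun k => inCopy (M := M) i (.y k)).card ≤ S.card := Finset.card_image_le
    omega

theorem gadgetChain_maxDegree (hn : 1 ≤ n) (hM : 2 ≤ n ∨ M = 1) (hpos : 0 < M) :
    (gadgetChain n M).maxDegree = 2 * n := by
  classical
  refine le_antisymm (SimpleGraph.maxDegree_le_of_forall_degree_le _ _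
    (gadgetChain_degree_le hn hM)) (le_trans ?_ (SimpleGraph.degree_le_maxDegree _ (.v ⟨0, hpos⟩)))
  rw [← SimpleGraph.card_neighborFinset_eq_degree]
  calc 2 * n = (Finset.univ.image fun j => (ChainVertex.x ⟨0, hpos⟩ j : ChainVertex n M)).card := by
        rw [Finset.card_image_of_injective _ fun j j' h => by simpa using h]
        simp
    _ ≤ _ := Finset.card_le_card fun b hb => by
        obtain ⟨j, -, rfl⟩ := Finset.mem_image.1 hb
        simpa using gadgetChain_adj_v_x _ j

end Chain

/-! ### The cyclic coloring -/

section CyclicColoring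

variable {n M : ℕ}

theorem mul_two_mul_sub_one_add (hn : 1 ≤ n) : n * (2 * n - 1) + n = 2 * n ^ 2 := by
  obtain ⟨m, rfl⟩ : ∃ m, n = m + 1 := ⟨n - 1, by omega⟩
  rw [show 2 * (m + 1) - 1 = 2 * m + 1 by omega]
  ring

/-- The pattern of colors in a gadget: all the numbers `0, …, 2n²` occur, and two vertices have the
same color if and only if they form a pair `x_{2ℓ-1}, x_{2ℓ}`. -/
def gadgetColor : GadgetVertex n → ℕ
  | .v => 2 * n ^ 2
  | .x j => n * (2 * n - 1) + (j : ℕ) / 2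
  | .y k => if (k : ℕ) = 0 then 0 else if (k : ℕ) + 1 = n * (2 * n - 1) then 1 else k + 1

theorem gadgetColor_y_lt (k : Fin (n * (2 * n - 1))) :
    gadgetColor (.y k) < n * (2 * n - 1) := by
  have := k.2
  simp only [gadgetColor]
  split_ifs <;> omega

theorem gadgetColor_y_injective :
    Function.Injective fun k : Fin (n * (2 * n - 1)) => gadgetColor (.y k) := by
  intro k k' h
  have := k.2
  have := k'.2
  simp only [gadgetColor] at h
  refine Fin.ext ?_
  split_ifs at h <;> omega

theorem le_gadgetColor_x (j : Fin (2 * n)) :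
    n * (2 * n - 1) ≤ gadgetColor (.x j) := Nat.le_add_right _ _

theorem gadgetColor_x_lt (j : Fin (2 * n)) : gadgetColor (.x j) < 2 * n ^ 2 := by
  have hj := j.2
  have := mul_two_mul_sub_one_add (n := n) (by omega)
  simp only [gadgetColor]
  omega

theorem gadgetColor_lt (g : GadgetVertex n) : gadgetColor g < 2 * n ^ 2 + 1 := by
  cases g with
  | v => exact Nat.lt_succ_self _
  | x j => exact (gadgetColor_x_lt j).trans (Nat.lt_succ_self _)
  | y k =>
    have := gadgetColor_y_lt k
    have hn : 1 ≤ n := Nat.one_le_iff_ne_zero.2 fun h => by subst h; simpa using k.2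
    have := mul_two_mul_sub_one_add hn
    omega

theorem exists_gadgetColor_eq (hn : 1 ≤ n) {t : ℕ} (ht : t < 2 * n ^ 2 + 1) :
    ∃ g : GadgetVertex n, gadgetColor g = t := by
  have hN := mul_two_mul_sub_one_add hn
  have hN0 : 0 < n * (2 * n - 1) := Nat.mul_pos (by omega) (by omega)
  rcases lt_or_ge t (n * (2 * n - 1)) with h | h
  · rcases Nat.lt_or_ge t 2 with h2 | h2
    · rcases Nat.eq_zero_or_pos t with rfl | h0
      · exact ⟨.y ⟨0, hN0⟩, by simp [gadgetColor]⟩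
      · refine ⟨.y ⟨n * (2 * n - 1) - 1, by omega⟩, ?_⟩
        simp only [gadgetColor]
        split_ifs <;> omega
    · refine ⟨.y ⟨t - 1, by omega⟩, ?_⟩
      simp only [gadgetColor]
      split_ifs <;> omega
  · rcases Nat.lt_or_ge t (2 * n ^ 2) with h2 | h2
    · refine ⟨.x ⟨2 * (t - n * (2 * n - 1)), by omega⟩, ?_⟩
      simp only [gadgetColor]
      omega
    · exact ⟨.v, by simp only [gadgetColor]; omega⟩

/-- The coloring of a chain in which the colors of the `i`-th copy are the pattern `gadgetColor`
shifted by `i`.  A vertex `y` with number `p` is assigned to the copy `p / (n(2n-1) - 1)`, so that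
the last vertex `y` of a copy counts as the first one of the next copy.  For `n = 1` the divisor
vanishes, and as `p / 0 = 0` and `p % 0 = p`, the only vertex `y`, with the number `0`, gets the
color `0`. -/
def chainColoring (n M : ℕ) : ChainVertex n M → ZMod (2 * n ^ 2 + 1)
  | .v i => ((i + 2 * n ^ 2 : ℕ) : ZMod (2 * n ^ 2 + 1))
  | .x i j => ((i + (n * (2 * n - 1) + (j : ℕ) / 2) : ℕ) : ZMod (2 * n ^ 2 + 1))
  | .y p => (((p : ℕ) / (n * (2 * n - 1) - 1) + if (p : ℕ) % (n * (2 * n - 1) - 1) = 0 then 0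
      else (p : ℕ) % (n * (2 * n - 1) - 1) + 1 : ℕ) : ZMod (2 * n ^ 2 + 1))

theorem chainColoring_inCopy (hn : 1 ≤ n) (hM : 2 ≤ n ∨ M = 1) (i : Fin M) (g : GadgetVertex n) :
    chainColoring n M (inCopy i g) = ((i + gadgetColor g : ℕ) : ZMod (2 * n ^ 2 + 1)) := by
  cases g with
  | v => rfl
  | x j => rfl
  | y k =>
    have hk := k.2
    simp only [chainColoring, inCopy, gadgetColor]
    congr 1
    rcases Nat.lt_or_ge n 2 with h1 | h2
    · obtain rfl : n = 1 := by omega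
      obtain rfl : M = 1 := by omega
      simp
    · have hN : 2 * (2 * n - 1) ≤ n * (2 * n - 1) := Nat.mul_le_mul_right _ h2
      generalize n * (2 * n - 1) = N at *
      rcases Nat.lt_or_ge (k : ℕ) (N - 1) with hlt | hge
      · rw [Nat.mul_add_mod_of_lt hlt, Nat.mul_comm (i : ℕ), Nat.mul_add_div (by omega),
          Nat.div_eq_of_lt hlt]
        split_ifs <;> omega
      · obtain hkN : (k : ℕ) = N - 1 := by omega
        rw [hkN, ← Nat.succ_mul, Nat.mul_mod_left, Nat.mul_div_cancel _ (by omega)]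
        split_ifs <;> omega

theorem gadgetColor_eq_of_chainColoring_eq (hn : 1 ≤ n) (hM : 2 ≤ n ∨ M = 1) {i : Fin M}
    {g g' : GadgetVertex n}
    (h : chainColoring n M (inCopy i g) = chainColoring n M (inCopy i g')) :
    gadgetColor g = gadgetColor g' := by
  rw [chainColoring_inCopy hn hM, chainColoring_inCopy hn hM, Nat.cast_add, Nat.cast_add,
    add_right_inj, ZMod.natCast_eq_natCast_iff', Nat.mod_eq_of_lt (gadgetColor_lt g),
    Nat.mod_eq_of_lt (gadgetColor_lt g')] at h
  exact h

/-- Every color occurs in every copy. -/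
theorem exists_chainColoring_inCopy_eq (hn : 1 ≤ n) (hM : 2 ≤ n ∨ M = 1) (i : Fin M)
    (a : ZMod (2 * n ^ 2 + 1)) : ∃ g, chainColoring n M (inCopy i g) = a := by
  obtain ⟨g, hg⟩ := exists_gadgetColor_eq hn (ZMod.val_lt (a - ((i : ℕ) : ZMod (2 * n ^ 2 + 1))))
  refine ⟨g, ?_⟩
  rw [chainColoring_inCopy hn hM, hg, Nat.cast_add, ZMod.natCast_zmod_val]
  ring

theorem isAcyclicColoring_chainColoring (hn : 1 ≤ n) (hM : 2 ≤ n ∨ M = 1) :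
    IsAcyclicColoring (gadgetChain n M) (chainColoring n M) := by
  have hN := mul_two_mul_sub_one_add hn
  have key : ∀ (i : Fin M) (j : Fin (2 * n)) (b : ChainVertex n M),
      (gadgetChain n M).Adj (.x i j) b → chainColoring n M (.x i j) ≠ chainColoring n M b := by
    intro i j b hb h
    have h1 := le_gadgetColor_x j
    have h2 := gadgetColor_x_lt j
    rcases gadgetChain_adj_x_iff.1 hb with rfl | ⟨k, -, rfl⟩
    · have := gadgetColor_eq_of_chainColoring_eq hn hM (i := i) (g := .x j) (g' := .v) h
      exact h2.ne this
    · have := gadgetColor_eq_of_chainColoring_eq hn hM (i := i) (g := .x j) (g' := .y k) h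
      have := gadgetColor_y_lt k
      omega
  refine isAcyclicColoring_of_injOn_neighborSet (X := {u | ∃ i j, u = .x i j})
    (fun u w h => ?_) (fun u w h => gadgetChain_adj_exists_x h) ?_
  · rcases gadgetChain_adj_exists_x h with ⟨i, j, rfl⟩ | ⟨i, j, rfl⟩
    · exact key i j w h
    · exact (key i j u h.symm).symm
  · rintro _ ⟨i, j, rfl⟩ b hb b' hb' h
    have hv : ∀ k, gadgetColor (n := n) .v ≠ gadgetColor (n := n) (.y k) := fun k => by
      have := gadgetColor_y_lt k
      simp only [gadgetColor] at this ⊢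
      omega
    rcases gadgetChain_adj_x_iff.1 hb with rfl | ⟨k, -, rfl⟩ <;>
    rcases gadgetChain_adj_x_iff.1 hb' with rfl | ⟨k', -, rfl⟩
    · rfl
    · exact absurd (gadgetColor_eq_of_chainColoring_eq hn hM (i := i) (g := .v) h) (hv k')
    · exact absurd (gadgetColor_eq_of_chainColoring_eq hn hM (i := i) (g' := .v) h).symm (hv k)
    · rw [gadgetColor_y_injective (gadgetColor_eq_of_chainColoring_eq hn hM h)]

/-- A vertex `y` of a gadget lies on a 4-cycle through `v` and a pair of vertices `x` of equal
color. -/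
theorem exists_four_cycle (i : Fin M) (k : Fin (n * (2 * n - 1))) :
    ∃ j j' : Fin (2 * n), j ≠ j' ∧ (gadgetChain n M).Adj (.x i j) (inCopy i (.y k)) ∧
      (gadgetChain n M).Adj (.x i j') (inCopy i (.y k)) ∧
      chainColoring n M (.x i j) = chainColoring n M (.x i j') := by
  have hlt : (k : ℕ) / (2 * n - 1) < n := Nat.div_lt_of_lt_mul (k.2.trans_eq (mul_comm _ _))
  refine ⟨⟨2 * ((k : ℕ) / (2 * n - 1)), by omega⟩, ⟨2 * ((k : ℕ) / (2 * n - 1)) + 1, by omega⟩,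
    by simp [Fin.ext_iff], gadgetChain_adj_x_iff.2 (Or.inr ⟨k, ?_, rfl⟩),
    gadgetChain_adj_x_iff.2 (Or.inr ⟨k, ?_, rfl⟩), ?_⟩
  · simp only
    omega
  · simp only
    omega
  · simp only [chainColoring]
    congr 3
    omega

theorem isLocked_chainColoring_v (hn : 1 ≤ n) (hM : 2 ≤ n ∨ M = 1) (i : Fin M) :
    IsLocked (gadgetChain n M) (chainColoring n M) (.v i) := by
  intro a _ ha
  obtain ⟨g, rfl⟩ := exists_chainColoring_inCopy_eq hn hM i a
  cases g with
  | v => exact absurd rfl ha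
  | x j => exact Or.inl ⟨_, gadgetChain_adj_v_x i j, rfl⟩
  | y k =>
    obtain ⟨j, j', hne, h1, h2, h3⟩ := exists_four_cycle i k
    exact Or.inr ⟨.x i j, _, .x i j', gadgetChain_adj_v_x i j, h1, h2.symm,
      (gadgetChain_adj_v_x i j').symm, by simpa using hne, by simp [inCopy], h3, rfl⟩

/-- All the vertices of the 4-cycle `G_1` are locked. -/
theorem isLocked_chainColoring_one (u : ChainVertex 1 1) :
    IsLocked (gadgetChain 1 1) (chainColoring 1 1) u := by
  have hM : 2 ≤ 1 ∨ 1 = 1 := Or.inr rfl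
  have hxy : ∀ i j k, (gadgetChain 1 1).Adj (.x i j) (inCopy i (.y k)) := fun i j k =>
    gadgetChain_adj_x_iff.2 (Or.inr ⟨k, by have := k.2; have := j.2; omega, rfl⟩)
  cases u with
  | v i => exact isLocked_chainColoring_v le_rfl hM i
  | x i j =>
    intro a _ ha
    obtain ⟨g, rfl⟩ := exists_chainColoring_inCopy_eq le_rfl hM i a
    cases g with
    | v => exact Or.inl ⟨_, (gadgetChain_adj_v_x i j).symm, rfl⟩
    | x j' =>
      refine absurd ?_ ha
      simp only [chainColoring, inCopy]
      congr 3
      omega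
    | y k => exact Or.inl ⟨_, hxy i j k, rfl⟩
  | y p =>
    obtain ⟨k, hk⟩ : ∃ k : Fin (1 * (2 * 1 - 1)), (.y p : ChainVertex 1 1) = inCopy 0 (.y k) := by
      refine ⟨⟨0, by omega⟩, ?_⟩
      simp only [inCopy, ChainVertex.y.injEq, Fin.ext_iff]
      have := p.2
      omega
    rw [hk]
    intro a _ ha
    obtain ⟨g, rfl⟩ := exists_chainColoring_inCopy_eq le_rfl hM 0 a
    cases g with
    | v =>
      exact Or.inr ⟨.x 0 0, .v 0, .x 0 1, (hxy 0 0 k).symm, (gadgetChain_adj_v_x 0 0).symm,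
        gadgetChain_adj_v_x 0 1, hxy 0 1 k, by simp, by simp [inCopy], rfl, rfl⟩
    | x j => exact Or.inl ⟨_, (hxy 0 j k).symm, rfl⟩
    | y k' =>
      refine absurd ?_ ha
      rw [show k' = k from Fin.ext (by omega)]

/-- Every color class contains a locked vertex: in a chain of `2n²+1` gadgets every color is the
color of a vertex `v`, and for `n = 1` all the vertices are locked. -/
theorem exists_isLocked_chainColoring (hn : 1 ≤ n)
    (hM : (2 ≤ n ∧ M = 2 * n ^ 2 + 1) ∨ (n = 1 ∧ M = 1)) {a : ZMod (2 * n ^ 2 + 1)}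
    (ha : a ∈ Set.range (chainColoring n M)) :
    ∃ u, chainColoring n M u = a ∧ IsLocked (gadgetChain n M) (chainColoring n M) u := by
  rcases hM with ⟨h2, rfl⟩ | ⟨rfl, rfl⟩
  -- The vertex `v` of the `i`-th copy has the color `i + 2n²`.
  · refine ⟨.v ⟨(a - ((2 * n ^ 2 : ℕ) : ZMod (2 * n ^ 2 + 1))).val, ZMod.val_lt _⟩, ?_,
      isLocked_chainColoring_v hn (Or.inl h2) _⟩
    rw [chainColoring, Nat.cast_add, ZMod.natCast_zmod_val]
    ring
  · obtain ⟨u, rfl⟩ := ha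
    exact ⟨u, rfl, isLocked_chainColoring_one u⟩

theorem numColors_chainColoring (hn : 1 ≤ n) (hM : 2 ≤ n ∨ M = 1) (hpos : 0 < M) :
    numColors (chainColoring n M) = 2 * n ^ 2 + 1 := by
  have hsurj : Function.Surjective (chainColoring n M) := fun a =>
    (exists_chainColoring_inCopy_eq hn hM ⟨0, hpos⟩ a).imp' (inCopy ⟨0, hpos⟩) fun _ h => h
  rw [numColors, hsurj.range_eq, Set.ncard_univ, Nat.card_zmod]

theorem isMinimalAcyclicColoring_chainColoring (hn : 1 ≤ n)
    (hM : (2 ≤ n ∧ M = 2 * n ^ 2 + 1) ∨ (n = 1 ∧ M = 1)) :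
    IsMinimalAcyclicColoring (gadgetChain n M) (chainColoring n M) :=
  isMinimalAcyclicColoring_of_isLocked
    (isAcyclicColoring_chainColoring hn (hM.imp And.left And.right))
    fun _ => exists_isLocked_chainColoring hn hM

theorem isCyclicChainColoring_chainColoring (h2 : 2 ≤ n) :
    IsCyclicChainColoring n (chainColoring n (2 * n ^ 2 + 1)) := by
  have hn : 1 ≤ n := by omega
  have hN : 2 * (2 * n - 1) ≤ n * (2 * n - 1) := Nat.mul_le_mul_right _ h2
  constructor
  all_goals intros
  all_goals rw [chainColoring_inCopy hn (Or.inl h2)]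
  all_goals congr 1
  all_goals simp only [gadgetColor]
  all_goals first | omega | (split_ifs <;> omega)

/-- The residues in `0, …, 2n²` turn the cyclic coloring into a coloring with natural numbers. -/
theorem le_acyclicBChromaticNumber_gadgetChain (hn : 1 ≤ n)
    (hM : (2 ≤ n ∧ M = 2 * n ^ 2 + 1) ∨ (n = 1 ∧ M = 1)) :
    2 * n ^ 2 + 1 ≤ acyclicBChromaticNumber (gadgetChain n M) := by
  have hM' : 2 ≤ n ∨ M = 1 := hM.imp And.left And.right
  have hinj := ZMod.val_injective (2 * n ^ 2 + 1)
  refine le_csSup bddAbove_numColors ⟨ZMod.val ∘ chainColoring n M,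
    isMinimalAcyclicColoring_of_isLocked
      ((isAcyclicColoring_chainColoring hn hM').comp_injective hinj) ?_, ?_⟩
  · rintro _ ⟨w, rfl⟩
    obtain ⟨u, h1, h2⟩ := exists_isLocked_chainColoring hn hM ⟨w, rfl⟩
    exact ⟨u, congrArg ZMod.val h1, h2.comp _⟩
  · rw [numColors, Set.range_comp, Set.ncard_image_of_injective _ hinj]
    exact numColors_chainColoring hn hM' (by omega)

theorem maDegree_gadgetChain_le (hn : 1 ≤ n) (hM : 2 ≤ n ∨ M = 1) :
    maDegree (gadgetChain n M) ≤ 2 * n ^ 2 + 1 := by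
  have h := two_mul_maDegree_le (D := 2 * n) (by omega) (gadgetChain_degree_le (M := M) hn hM)
  have : (2 * n) ^ 2 = 4 * n ^ 2 := by ring
  omega

end CyclicColoring

end AcyclicB

theorem mainTheorem4 :
    (∀ n : ℕ, 1 ≤ n →
      (AcyclicB.extremalGraph n).maxDegree = 2 * n ∧
      AcyclicB.acyclicBChromaticNumber (AcyclicB.extremalGraph n) =
        AcyclicB.maDegree (AcyclicB.extremalGraph n) ∧
      (AcyclicB.maDegree (AcyclicB.extremalGraph n) : ℚ) =
        1 / 2 * ((AcyclicB.extremalGraph n).maxDegree : ℚ) ^ 2 + 1) ∧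
    (∀ m n : ℕ, 1 ≤ m → 1 ≤ n → m ≠ n →
      IsEmpty (AcyclicB.extremalGraph m ≃g AcyclicB.extremalGraph n)) ∧
    (∀ n : ℕ, 2 ≤ n →
      ∃ c : AcyclicB.ChainVertex n (2 * n ^ 2 + 1) → ZMod (2 * n ^ 2 + 1),
        AcyclicB.IsCyclicChainColoring n c ∧
        AcyclicB.IsMinimalAcyclicColoring (AcyclicB.gadgetChain n (2 * n ^ 2 + 1)) c ∧
        AcyclicB.numColors c = 2 * n ^ 2 + 1) := by
  have hM : ∀ n, 1 ≤ n → (2 ≤ n ∧ AcyclicB.numGadgets n = 2 * n ^ 2 + 1) ∨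
      (n = 1 ∧ AcyclicB.numGadgets n = 1) := by
    intro n hn
    rw [AcyclicB.numGadgets]
    split_ifs <;> omega
  have hdeg : ∀ n, 1 ≤ n → (AcyclicB.extremalGraph n).maxDegree = 2 * n := fun n hn =>
    AcyclicB.gadgetChain_maxDegree hn ((hM n hn).imp And.left And.right)
      (by have := hM n hn; omega)
  refine ⟨fun n hn => ⟨hdeg n hn, ?_⟩, fun m n hm hn hmn => ⟨fun f => hmn ?_⟩, fun n h2 => ?_⟩
  · have h1 := AcyclicB.le_acyclicBChromaticNumber_gadgetChain hn (hM n hn)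
    have h2 := AcyclicB.acyclicBChromaticNumber_le_maDegree (G := AcyclicB.extremalGraph n)
    have h3 := AcyclicB.maDegree_gadgetChain_le hn ((hM n hn).imp And.left And.right)
    have h4 : AcyclicB.maDegree (AcyclicB.extremalGraph n) = 2 * n ^ 2 + 1 :=
      le_antisymm h3 (h1.trans h2)
    refine ⟨le_antisymm h2 (h4.trans_le h1), ?_⟩
    rw [h4, hdeg n hn]
    push_cast
    ring
  · have := f.maxDegree_eq
    rw [hdeg m hm, hdeg n hn] at this
    omega
  · exact ⟨AcyclicB.chainColoring n (2 * n ^ 2 + 1),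
      AcyclicB.isCyclicChainColoring_chainColoring h2,
      AcyclicB.isMinimalAcyclicColoring_chainColoring (by omega) (Or.inl ⟨h2, rfl⟩),
      AcyclicB.numColors_chainColoring (by omega) (Or.inl h2) (by omega)⟩
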